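/- **Theorem (sVS-SQN with fixed Moreau smoothing).** Let $f=h+g$ on $\mathbb R^n$, where $h:\mathbb R^n\to(-\infty,\infty]$ is closed, convex and proper, $g(x)=\mathbb E[F(x,\omega)]$, and for every $\omega$ the function $F(\cdot,\omega)$ is $\tau$-strongly convex and $L$-smooth ($\tau,L>0$). Let $x^*$ be the minimizer of $f$. For a closed, convex, proper $\varphi$ and $\eta>0$ put $$\varphi_\eta(x)=\min_u\Big\{\varphi(u)+\tfrac1{2\eta}\|u-x\|^2\Big\},\qquad \mathrm{prox}_{\eta,\varphi}(x)=\mathrm{argmin}_u\Big\{\varphi(u)+\tfrac1{2\eta}\|u-x\|^2\Big\},\qquad \nabla\varphi_\eta(x)=\tfrac1\eta\big(x-\mathrm{prox}_{\eta,\varphi}(x)\big).$$ Let $0<\eta\le\min\{2/L,\,(4(n+1)^2/\tau^2)^{1/3}\}$, let $N_0\ge1$ be an integer, $q\in(0,1)$, $N_k=\lceil N_0q^{-k}\rceil$, $\gamma=\frac{\tau\eta^2}{4(1+n)}$, and $$d=1-\frac{\tau^2\eta^3}{4(n+1)^2(1+\eta\tau)},\qquad q\ne d,\qquad c_1=\max\{q,d\},\quad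 c_2=\min\{q,d\}.$$ Let $x_0$ be a random vector with $\mathbb E\|x_0\|^2<\infty$ and $$x_{k+1}=x_k-\gamma H_k\big(\nabla f_\eta(x_k)+\bar w_k\big),\qquad \bar w_k=\nabla (f_{N_k})_\eta(x_k)-\nabla f_\eta(x_k),\qquad f_{N_k}=h+\frac1{N_k}\sum_{j=1}^{N_k}F(\cdot,\omega_{j,k}),$$ where the $\omega_{j,k}$ are samples of $\omega$. Let $(\mathcal F_k)$ be a filtration, and assume that for all $k\ge0$ the following holds. * The matrix $H_k$ is $\mathcal F_k$-measurable, symmetric and positive definite, with $\frac{\eta}{n+1}I\preceq H_k\preceq\frac{n+1}{\eta\tau}I$ almost surely (the eigenvalue bounds that belong to memory $m=1$). * For some $\nu>0$, $\mathbb E[\|\bar u_k\|^2\mid\mathcal F_k]\le\nu^2/N_k$ almost surely, where $\bar u_k=\nabla g(y_k)-\frac1{N_k}\sum_{j=1}^{N_k}\nabla_xF(y_k,\omega_{j,k})$ and $y_k=\mathrm{prox}_{\eta,f}(x_k)$. Put $\nu_1=\nu/(\eta\tau)$. Then: (i) For all $k\ge0$, $\mathbb E\|x_{k+1}-x^*\|^2\le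 D\,c_1^{k+1}$, where $$D=\frac{2\,\mathbb E[f_\eta(x_0)-f_\eta(x^*)]\,(1+\eta\tau)}{\tau}+\frac{5(1+\eta\tau)\,\eta\,\nu_1^2}{8\tau N_0(c_1-c_2)} .$$ (ii) There is a constant $C>0$ such that for every $\epsilon\in(0,1/2]$ there is a $K$ with $K+1\le C\ln(1/\epsilon)$, $\mathbb E\|x_{K+1}-x^*\|^2\le\epsilon$ and $\mathbb E[f_\eta(x_{K+1})-f_\eta(x^*)]\le\epsilon$, and, if $d<q$, also $\sum_{k=0}^{K}N_k\le C/\epsilon$. So an $\epsilon$-solution takes $\mathcal O(\ln(1/\epsilon))$ iterations and, if $d<q$, $\mathcal O(1/\epsilon)$ samples. -/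

import Mathlib

open MeasureTheory ProbabilityTheory Set

namespace MoreauSQN

/-- `ℝⁿ` with the Euclidean norm. -/
abbrev Vec (n : ℕ) : Type := EuclideanSpace ℝ (Fin n)

/-- `h : ℝⁿ → (-∞, ∞]` is closed (lower semicontinuous), convex (its epigraph is convex)
and proper (never `-∞`, and not identically `+∞`). -/
structure IsClosedConvexProper {n : ℕ} (h : Vec n → EReal) : Prop where
  closed : LowerSemicontinuous h
  convex : Convex ℝ {p : Vec n × ℝ | h p.1 ≤ (p.2 : EReal)}
  ne_bot : ∀ x, h x ≠ ⊥
  exists_ne_top : ∃ x, h x ≠ ⊤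

/-- `φ` is differentiable with an `L`-Lipschitz gradient. -/
def IsLSmooth {n : ℕ} (L : ℝ) (φ : Vec n → ℝ) : Prop :=
  Differentiable ℝ φ ∧ ∀ x y, ‖gradient φ x - gradient φ y‖ ≤ L * ‖x - y‖

noncomputable section

/-- The function `u ↦ φ(u) + ‖u - x‖² / (2η)`. -/
def proxObjective {n : ℕ} (φ : Vec n → EReal) (η : ℝ) (x u : Vec n) : EReal :=
  φ u + ((1 / (2 * η) * ‖u - x‖ ^ 2 : ℝ) : EReal)

/-- The Moreau envelope `φ_η(x) = inf_u { φ(u) + ‖u - x‖² / (2η) }`. -/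
def moreauEnvelope {n : ℕ} (φ : Vec n → EReal) (η : ℝ) (x : Vec n) : EReal :=
  ⨅ u, proxObjective φ η x u

/-- `prox_{η,φ}(x) = argmin_u { φ(u) + ‖u - x‖² / (2η) }`; for a closed, convex and proper `φ`
the minimizer exists and is unique (otherwise an arbitrary value). -/
def prox {n : ℕ} (φ : Vec n → EReal) (η : ℝ) (x : Vec n) : Vec n :=
  Classical.epsilon fun p => ∀ u, proxObjective φ η x p ≤ proxObjective φ η x u

/-- The gradient of the Moreau envelope, `∇φ_η(x) = (x - prox_{η,φ}(x)) / η`. -/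
def moreauGrad {n : ℕ} (φ : Vec n → EReal) (η : ℝ) (x : Vec n) : Vec n :=
  η⁻¹ • (x - prox φ η x)

/-- `g(x) = E[F(x, z)]`, with `z` distributed according to `𝒟`. -/
def expectedValue {n : ℕ} {Ξ : Type*} [MeasurableSpace Ξ] (F : Vec n → Ξ → ℝ) (𝒟 : Measure Ξ)
    (x : Vec n) : ℝ :=
  ∫ z, F x z ∂𝒟

/-- The sample average `(1/N) ∑_{j < N} F(x, z_j)`. -/
def sampleAverage {n : ℕ} {Ξ : Type*} (F : Vec n → Ξ → ℝ) (N : ℕ) (z : ℕ → Ξ) (x : Vec n) : ℝ :=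
  (1 / (N : ℝ)) * ∑ j ∈ Finset.range N, F x (z j)

/-- `φ = h + g` for an extended-valued `h` and a real-valued `g`. -/
def composite {n : ℕ} (h : Vec n → EReal) (g : Vec n → ℝ) (x : Vec n) : EReal :=
  h x + (g x : EReal)

/-- The batch size `N_k = ⌈N₀ q^{-k}⌉`. -/
def batchSize (N₀ : ℕ) (q : ℝ) (k : ℕ) : ℕ :=
  ⌈(N₀ : ℝ) * (q ^ k)⁻¹⌉₊

/-- The error `w̄ = ∇f_{η,N}(x) - ∇f_η(x)` in the gradient of the Moreau envelope, where
`f = h + E[F]` and `f_N = h + (1/N) ∑_{j < N} F(·, z_j)`. -/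
def gradError {n : ℕ} {Ξ : Type*} [MeasurableSpace Ξ] (h : Vec n → EReal) (F : Vec n → Ξ → ℝ)
    (𝒟 : Measure Ξ) (η : ℝ) (N : ℕ) (z : ℕ → Ξ) (x : Vec n) : Vec n :=
  moreauGrad (composite h (sampleAverage F N z)) η x
    - moreauGrad (composite h (expectedValue F 𝒟)) η x

/-- The sampling error at a point `y`: `∇g(y) - (1/N) ∑_{j < N} ∇ₓF(y, z_j)`, `g = E[F]`. -/
def samplingError {n : ℕ} {Ξ : Type*} [MeasurableSpace Ξ] (F : Vec n → Ξ → ℝ)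
    (𝒟 : Measure Ξ) (N : ℕ) (z : ℕ → Ξ) (y : Vec n) : Vec n :=
  gradient (expectedValue F 𝒟) y
    - (1 / (N : ℝ)) • ∑ j ∈ Finset.range N, gradient (fun u => F u (z j)) y

/-- The smoothed variable sample-size stochastic quasi-Newton scheme with a constant smoothing
parameter `η` and a constant steplength `γ`:
`x_{k+1} = x_k - γ H_k (∇f_η(x_k) + w̄_k)` almost surely, where `w̄_k` is the error made by using
the batch `ω_{0,k}, …, ω_{N_k-1,k}` of samples (here `z k j` is `ω_{j,k}`). -/
def IsSVSSQN {n : ℕ} {Ω Ξ : Type*} [MeasurableSpace Ω] [MeasurableSpace Ξ] (P : Measure Ω)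
    (h : Vec n → EReal) (F : Vec n → Ξ → ℝ) (𝒟 : Measure Ξ) (η γ : ℝ) (N : ℕ → ℕ)
    (z : ℕ → ℕ → Ω → Ξ) (H : ℕ → Ω → Matrix (Fin n) (Fin n) ℝ) (x : ℕ → Ω → Vec n) : Prop :=
  ∀ k, ∀ᵐ ω ∂P, x (k + 1) ω = x k ω - γ • Matrix.toEuclideanLin (H k ω)
    (moreauGrad (composite h (expectedValue F 𝒟)) η (x k ω)
      + gradError h F 𝒟 η (N k) (fun j => z k j ω) (x k ω))

/-- Properties of the inverse Hessian approximations: every `H_k` is `ℱ_k`-measurable, and almost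
surely symmetric positive definite with `lo I ⪯ H_k ⪯ hi I`. -/
def HessianApprox {n : ℕ} {Ω : Type*} [mΩ : MeasurableSpace Ω] (P : Measure Ω)
    (ℱ : Filtration ℕ mΩ) (lo hi : ℝ) (H : ℕ → Ω → Matrix (Fin n) (Fin n) ℝ) : Prop :=
  ∀ k, (∀ i j, Measurable[ℱ k] fun ω => H k ω i j) ∧
    ∀ᵐ ω ∂P, (H k ω).PosDef ∧
      (H k ω - lo • (1 : Matrix (Fin n) (Fin n) ℝ)).PosSemidef ∧
      (hi • (1 : Matrix (Fin n) (Fin n) ℝ) - H k ω).PosSemidef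

/-- The conditional second moment bound `E[‖ū_k‖² | ℱ_k] ≤ ν² / N_k` almost surely, where `ū_k` is
the sampling error at `prox_{η,f}(x_k)`. Integrability is part of the bound. -/
def SamplingMomentBound {n : ℕ} {Ω Ξ : Type*} [mΩ : MeasurableSpace Ω] [MeasurableSpace Ξ]
    (P : Measure Ω) (ℱ : Filtration ℕ mΩ) (h : Vec n → EReal) (F : Vec n → Ξ → ℝ) (𝒟 : Measure Ξ)
    (η ν : ℝ) (N : ℕ → ℕ) (z : ℕ → ℕ → Ω → Ξ) (x : ℕ → Ω → Vec n) : Prop :=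
  ∀ k,
    Integrable (fun ω => ‖samplingError F 𝒟 (N k) (fun j => z k j ω)
      (prox (composite h (expectedValue F 𝒟)) η (x k ω))‖ ^ 2) P ∧
    P[fun ω => ‖samplingError F 𝒟 (N k) (fun j => z k j ω)
      (prox (composite h (expectedValue F 𝒟)) η (x k ω))‖ ^ 2 | ℱ k]
        ≤ᵐ[P] fun _ => ν ^ 2 / (N k : ℝ)

end

end MoreauSQN

open MoreauSQN

/-!
Everything rests on a pathwise inequality for the Moreau envelope `f_η` of `f = h + g`; no property
of the conditional mean of the error `w̄_k` is used, since the proximal point of a sampled objective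
is biased anyway.

The functions `F(·, z)`, their sample averages and their expectation all satisfy `QuadBounds`: they
lie between two quadratics with a common slope. Optimality of the proximal point `y` of `x` says that
`∇f_η(x) - ∇g(y)` is a subgradient of `h` at `y` (`isSubgrad_prox`). From this, without any
differentiability theory for the envelope:

* `f_η` is `1/η`-smooth (`moreauEnvelope_descent`), grows at least like
  `τ / (2 (1 + ητ)) ‖x - x*‖²` (`sq_dist_le_moreauEnvelope_sub`), and satisfies the
  Polyak–Łojasiewicz inequality with the same modulus
  (`moreauEnvelope_sub_le_sq_norm_moreauGrad`);
* monotonicity of the subdifferential of `h` and strong monotonicity of the sampled gradient bound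
  `‖w̄_k‖` by `‖ū_k‖ / (1 + ητ)` (`norm_gradError_le`).

With `lo` and `hi` the eigenvalue bounds of `H_k` and `γ hi = η / 4`, one step gives
`f_η(x_{k+1}) ≤ f_η(x_k) - (γ lo / 2) ‖∇f_η(x_k)‖² + (η / 8) ‖w̄_k‖²` (`moreauEnvelope_step_le`),
so that the gap `f_η - f_η(x*)` contracts by the factor `d` up to an error of order `1 / N_k`, that
is, `q ^ k`. The expected gap then obeys a perturbed linear recursion
(`le_mul_max_pow_of_le_mul_add`), quadratic growth turns the gap into a squared distance, and the
first index at which the geometric bound drops below `ε` gives both complexities.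

A minimizer of `f` supplies a subgradient of `h`, and with it the affine minorant that makes the
proximal problems of all sampled objectives coercive.
-/

namespace MoreauSQN

open scoped RealInnerProductSpace

/-! ### Functions between two quadratics -/

/-- At every point `x`, the function `g` lies between the quadratics with slope `Dg x` and curvatures
`τ` and `2L`. This first-order form of strong convexity and smoothness passes to averages and to
expectations, and it makes `Dg` the gradient of `g`. -/
structure QuadBounds {n : ℕ} (τ L : ℝ) (g : Vec n → ℝ) (Dg : Vec n → Vec n) : Prop where
  lower : ∀ x u, g x + ⟪Dg x, u - x⟫ + τ / 2 * ‖u - x‖ ^ 2 ≤ g u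
  upper : ∀ x u, g u ≤ g x + ⟪Dg x, u - x⟫ + L * ‖u - x‖ ^ 2

theorem le_of_forall_le_add_mul {A B C : ℝ} (h : ∀ t : ℝ, 0 < t → t ≤ 1 → A ≤ B + t * C) :
    A ≤ B := by
  have ht : Filter.Tendsto (fun t : ℝ => B + t * C) (nhdsWithin 0 (Ioi 0)) (nhds B) := by
    have : Filter.Tendsto (fun t : ℝ => B + t * C) (nhds 0) (nhds (B + 0 * C)) :=
      (by fun_prop : Continuous fun t : ℝ => B + t * C).tendsto 0
    simpa using this.mono_left nhdsWithin_le_nhds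
  refine ge_of_tendsto ht ?_
  filter_upwards [Ioc_mem_nhdsGT (zero_lt_one' ℝ)] with t h1
  exact h t h1.1 h1.2

theorem hasDerivAt_comp_line {n : ℕ} {φ : Vec n → ℝ} {x s : Vec n} (hs : HasGradientAt φ s x)
    (v : Vec n) : HasDerivAt (fun t : ℝ => φ (x + t • v)) ⟪s, v⟫ 0 := by
  have hline : HasDerivAt (fun t : ℝ => x + t • v) v 0 := by
    simpa using ((hasDerivAt_id (0 : ℝ)).smul_const v).const_add x
  have hs' : HasFDerivAt φ (InnerProductSpace.toDual ℝ (Vec n) s) (x + (0 : ℝ) • v) := by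
    simpa using hasGradientAt_iff_hasFDerivAt.1 hs
  exact hs'.comp_hasDerivAt (0 : ℝ) hline

theorem StrongConvexOn.add_inner_gradient_le {n : ℕ} {τ : ℝ} {φ : Vec n → ℝ}
    (hφ : StrongConvexOn univ τ φ) {x s : Vec n} (hs : HasGradientAt φ s x) (u : Vec n) :
    φ x + ⟪s, u - x⟫ + τ / 2 * ‖u - x‖ ^ 2 ≤ φ u := by
  have hslope := (hasDerivAt_comp_line hs (u - x)).tendsto_slope_zero_right
  have hright : Filter.Tendsto (fun t : ℝ => φ u - φ x - (1 - t) * (τ / 2 * ‖u - x‖ ^ 2))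
      (nhdsWithin 0 (Ioi 0)) (nhds (φ u - φ x - (1 - 0) * (τ / 2 * ‖u - x‖ ^ 2))) :=
    ((by fun_prop : Continuous fun t : ℝ =>
      φ u - φ x - (1 - t) * (τ / 2 * ‖u - x‖ ^ 2)).tendsto 0).mono_left nhdsWithin_le_nhds
  have hle := le_of_tendsto_of_tendsto hslope hright (by
    filter_upwards [Ioc_mem_nhdsGT (zero_lt_one' ℝ)] with t ht
    have h1 := hφ.2 (mem_univ x) (mem_univ u) (sub_nonneg.2 ht.2) ht.1.le (by ring)
    have hp : (1 - t) • x + t • u = x + t • (u - x) := by module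
    rw [hp, norm_sub_rev x u] at h1
    simp only [smul_eq_mul, zero_add, zero_smul, add_zero] at h1 ⊢
    rw [inv_mul_le_iff₀ ht.1]
    nlinarith [h1])
  linarith

theorem QuadBounds.of_strongConvexOn_of_isLSmooth {n : ℕ} {τ L : ℝ} (hτ : 0 ≤ τ) {φ : Vec n → ℝ}
    (hφ : StrongConvexOn univ τ φ) (hL : IsLSmooth L φ) : QuadBounds τ L φ (gradient φ) where
  lower x u := hφ.add_inner_gradient_le (hL.1 x).hasGradientAt u
  upper x u := by
    have h1 := hφ.add_inner_gradient_le (hL.1 u).hasGradientAt x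
    have h2 : ⟪gradient φ u - gradient φ x, u - x⟫ ≤ L * ‖u - x‖ * ‖u - x‖ :=
      (real_inner_le_norm _ _).trans (mul_le_mul_of_nonneg_right (hL.2 u x) (norm_nonneg _))
    have h3 : ⟪gradient φ u, x - u⟫ = -⟪gradient φ u, u - x⟫ := by
      rw [← inner_neg_right, neg_sub]
    have h4 : 0 ≤ τ / 2 * ‖x - u‖ ^ 2 := by positivity
    rw [inner_sub_left] at h2
    nlinarith

namespace QuadBounds

variable {n : ℕ} {τ L : ℝ} {g : Vec n → ℝ} {Dg : Vec n → Vec n}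

theorem hasGradientAt (hg : QuadBounds τ L g Dg) (x : Vec n) : HasGradientAt g (Dg x) x := by
  rw [hasGradientAt_iff_isLittleO]
  refine (Asymptotics.IsBigO.of_bound (|τ / 2| + |L|) (Filter.Eventually.of_forall fun u => ?_)
    ).trans_isLittleO (?_ : (fun u => ‖u - x‖ ^ 2) =o[nhds x] fun u => u - x)
  · have h1 := hg.lower x u
    have h2 := hg.upper x u
    have h0 : (0 : ℝ) ≤ ‖u - x‖ ^ 2 := by positivity
    rw [Real.norm_eq_abs, Real.norm_of_nonneg h0, abs_le]
    have := mul_le_mul_of_nonneg_right (neg_abs_le (τ / 2)) h0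
    have := mul_le_mul_of_nonneg_right (le_abs_self L) h0
    have := mul_nonneg (abs_nonneg L) h0
    have := mul_nonneg (abs_nonneg (τ / 2)) h0
    constructor <;> nlinarith
  · exact Asymptotics.isLittleO_pow_sub_sub x one_lt_two

theorem gradient_eq (hg : QuadBounds τ L g Dg) (x : Vec n) : gradient g x = Dg x :=
  (hg.hasGradientAt x).gradient

theorem continuous (hg : QuadBounds τ L g Dg) : Continuous g :=
  continuous_iff_continuousAt.2 fun x => (hg.hasGradientAt x).differentiableAt.continuousAt

theorem strongly_monotone (hg : QuadBounds τ L g Dg) (x u : Vec n) :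
    τ * ‖u - x‖ ^ 2 ≤ ⟪Dg u - Dg x, u - x⟫ := by
  have h1 := hg.lower x u
  have h2 := hg.lower u x
  have h3 : ⟪Dg u, x - u⟫ = -⟪Dg u, u - x⟫ := by rw [← inner_neg_right, neg_sub]
  rw [norm_sub_rev x u] at h2
  rw [inner_sub_left]
  linarith

theorem sampleAverage {Ξ : Type*} {F : Vec n → Ξ → ℝ} {DF : Ξ → Vec n → Vec n}
    (hF : ∀ z, QuadBounds τ L (fun x => F x z) (DF z)) {N : ℕ} (hN : 0 < N) (z : ℕ → Ξ) :
    QuadBounds τ L (sampleAverage F N z)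
      (fun x => (1 / (N : ℝ)) • ∑ j ∈ Finset.range N, DF (z j) x) := by
  have hN' : (0 : ℝ) < N := by exact_mod_cast hN
  constructor <;> intro x u
  · have h := Finset.sum_le_sum fun j (_ : j ∈ Finset.range N) => (hF (z j)).lower x u
    simp only [Finset.sum_add_distrib, Finset.sum_const, Finset.card_range, nsmul_eq_mul] at h
    simp only [MoreauSQN.sampleAverage, inner_smul_left, sum_inner, conj_trivial]
    have := mul_le_mul_of_nonneg_left h (one_div_pos.2 hN').le
    calc _ = _ := ?_
      _ ≤ _ := this
    field_simp
  · have h := Finset.sum_le_sum fun j (_ : j ∈ Finset.range N) => (hF (z j)).upper x u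
    simp only [Finset.sum_add_distrib, Finset.sum_const, Finset.card_range, nsmul_eq_mul] at h
    simp only [MoreauSQN.sampleAverage, inner_smul_left, sum_inner, conj_trivial]
    have := mul_le_mul_of_nonneg_left h (one_div_pos.2 hN').le
    calc _ ≤ _ := this
      _ = _ := ?_
    field_simp

section Expectation

variable {Ξ : Type*} [MeasurableSpace Ξ] {𝒟 : Measure Ξ} [IsProbabilityMeasure 𝒟]
  {F : Vec n → Ξ → ℝ} {DF : Ξ → Vec n → Vec n}

/-- The slope is a pointwise limit of difference quotients, hence measurable in the sample, and the
two quadratics bound it by integrable functions. -/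
theorem integrable_inner (hFint : ∀ x, Integrable (F x) 𝒟)
    (hF : ∀ z, QuadBounds τ L (fun x => F x z) (DF z)) (x v : Vec n) :
    Integrable (fun z => ⟪DF z x, v⟫) 𝒟 := by
  have hmeas : AEStronglyMeasurable (fun z => ⟪DF z x, v⟫) 𝒟 := by
    refine aestronglyMeasurable_of_tendsto_ae Filter.atTop
      (f := fun (m : ℕ) z => ((m : ℝ) + 1) * (F (x + (1 / ((m : ℝ) + 1)) • v) z - F x z))
      (fun m => (((hFint _).sub (hFint _)).const_mul _).aestronglyMeasurable)
      (Filter.Eventually.of_forall fun z => ?_)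
    have hseq : Filter.Tendsto (fun m : ℕ => 1 / ((m : ℝ) + 1)) Filter.atTop
        (nhdsWithin 0 (Ioi 0)) :=
      tendsto_nhdsWithin_iff.2 ⟨tendsto_one_div_add_atTop_nhds_zero_nat,
        Filter.Eventually.of_forall fun m => by simp only [mem_Ioi]; positivity⟩
    simpa [Function.comp_def] using
      (hasDerivAt_comp_line ((hF z).hasGradientAt x) v).tendsto_slope_zero_right.comp hseq
  have hdiff : Integrable (fun z => |F (x + v) z - F x z| + (|τ / 2| + |L|) * ‖v‖ ^ 2) 𝒟 :=
    ((hFint _).sub (hFint _)).abs.add (integrable_const _)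
  refine hdiff.mono' hmeas (Filter.Eventually.of_forall fun z => ?_)
  have h1 := (hF z).lower x (x + v)
  have h2 := (hF z).upper x (x + v)
  rw [add_sub_cancel_left] at h1 h2
  have h0 : (0 : ℝ) ≤ ‖v‖ ^ 2 := by positivity
  rw [Real.norm_eq_abs, abs_le]
  have := mul_le_mul_of_nonneg_right (neg_abs_le (τ / 2)) h0
  have := mul_le_mul_of_nonneg_right (le_abs_self L) h0
  have := mul_nonneg (abs_nonneg L) h0
  have := mul_nonneg (abs_nonneg (τ / 2)) h0
  have := neg_abs_le (F (x + v) z - F x z)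
  have := le_abs_self (F (x + v) z - F x z)
  constructor <;> nlinarith

theorem expectedValue (hFint : ∀ x, Integrable (F x) 𝒟)
    (hF : ∀ z, QuadBounds τ L (fun x => F x z) (DF z)) :
    ∃ G, QuadBounds τ L (expectedValue F 𝒟) G := by
  have hv := fun x v => integrable_inner hFint hF x v
  have hint : ∀ x, Integrable (fun z => DF z x) 𝒟 := fun x => by
    have hsum : (fun z => DF z x) = fun z =>
        ∑ i, ⟪DF z x, EuclideanSpace.basisFun (Fin n) ℝ i⟫ • EuclideanSpace.basisFun (Fin n) ℝ i := by
      funext z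
      conv_lhs => rw [← (EuclideanSpace.basisFun (Fin n) ℝ).sum_repr' (DF z x)]
      simp only [real_inner_comm]
    rw [hsum]
    exact integrable_finsetSum _ fun i _ => (hv x _).smul_const _
  have hinner : ∀ x v, ∫ z, ⟪DF z x, v⟫ ∂𝒟 = ⟪∫ z, DF z x ∂𝒟, v⟫ := fun x v => by
    have := integral_inner (𝕜 := ℝ) (hint x) v
    simp only [real_inner_comm v] at this ⊢
    exact this
  have hquad : ∀ x v (c : ℝ), ∫ z, (F x z + ⟪DF z x, v⟫ + c) ∂𝒟
      = MoreauSQN.expectedValue F 𝒟 x + ⟪∫ z, DF z x ∂𝒟, v⟫ + c := fun x v c => by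
    have hadd : Integrable (fun z => F x z + ⟪DF z x, v⟫) 𝒟 := (hFint x).add (hv x v)
    rw [integral_add hadd (integrable_const _),
      integral_add (hFint x) (hv x v), integral_const, hinner, probReal_univ, one_smul]
    rfl
  refine ⟨fun x => ∫ z, DF z x ∂𝒟, ⟨fun x u => ?_, fun x u => ?_⟩⟩
  · rw [← hquad]
    exact integral_mono (((hFint x).add (hv x (u - x))).add (integrable_const _)) (hFint u)
      fun z => (hF z).lower x u
  · rw [← hquad]
    exact integral_mono (hFint u) (((hFint x).add (hv x (u - x))).add (integrable_const _))
      fun z => (hF z).upper x u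

end Expectation

end QuadBounds

/-! ### Subgradients and the proximal point -/

/-- `s` is a subgradient of `h` at the point `p` of its domain. The inequality is stated between real
numbers, on the domain of `h`; it is trivial elsewhere. -/
structure IsSubgrad {n : ℕ} (h : Vec n → EReal) (p s : Vec n) : Prop where
  ne_top : h p ≠ ⊤
  le : ∀ u, h u ≠ ⊤ → (h p).toReal + ⟪s, u - p⟫ ≤ (h u).toReal

section Envelope

variable {n : ℕ} {h : Vec n → EReal} {g : Vec n → ℝ} {Dg : Vec n → Vec n} {τ L η : ℝ}

theorem IsSubgrad.monotone {p s p' s' : Vec n} (hs : IsSubgrad h p s) (hs' : IsSubgrad h p' s') :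
    0 ≤ ⟪s' - s, p' - p⟫ := by
  have h1 := hs.le p' hs'.ne_top
  have h2 := hs'.le p hs.ne_top
  have h3 : ⟪s', p - p'⟫ = -⟪s', p' - p⟫ := by rw [← inner_neg_right, neg_sub]
  rw [inner_sub_left]
  linarith

theorem IsClosedConvexProper.coe_toReal (hh : IsClosedConvexProper h) {u : Vec n} (hu : h u ≠ ⊤) :
    (((h u).toReal : ℝ) : EReal) = h u :=
  EReal.coe_toReal hu (hh.ne_bot u)

/-- First-order optimality: at a minimizer of `h + ψ`, the negative slope of `ψ` is a subgradient
of `h`. Only a quadratic upper bound on `ψ` at the minimizer is needed. -/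
theorem IsClosedConvexProper.isSubgrad_of_forall_le (hh : IsClosedConvexProper h) {ψ : Vec n → ℝ}
    {p s : Vec n} {c : ℝ} (hψ : ∀ u, ψ u ≤ ψ p + ⟪s, u - p⟫ + c * ‖u - p‖ ^ 2)
    (hmin : ∀ u, h p + (ψ p : EReal) ≤ h u + (ψ u : EReal)) : IsSubgrad h p (-s) := by
  have hp : h p ≠ ⊤ := by
    obtain ⟨u, hu⟩ := hh.exists_ne_top
    intro hp
    have h1 := hmin u
    rw [hp, EReal.top_add_coe, top_le_iff, ← hh.coe_toReal hu, ← EReal.coe_add] at h1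
    exact EReal.coe_ne_top _ h1
  refine ⟨hp, fun u hu => ?_⟩
  have key : (h p).toReal - (h u).toReal ≤ ⟪s, u - p⟫ := by
    refine le_of_forall_le_add_mul (C := c * ‖u - p‖ ^ 2) fun t ht ht1 => ?_
    have hconv := hh.convex (x := (p, (h p).toReal)) (hh.coe_toReal hp).ge
      (y := (u, (h u).toReal)) (hh.coe_toReal hu).ge (sub_nonneg.2 ht1) ht.le (by ring)
    simp only [mem_ofPred_eq, Prod.smul_mk, Prod.mk_add_mk, smul_eq_mul] at hconv
    have hpt : (1 - t) • p + t • u = p + t • (u - p) := by module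
    rw [hpt] at hconv
    have h1 := (hmin (p + t • (u - p))).trans (add_le_add_left hconv _)
    rw [← hh.coe_toReal hp, ← EReal.coe_add, ← EReal.coe_add, EReal.coe_le_coe_iff,
      EReal.toReal_coe] at h1
    have h2 := hψ (p + t • (u - p))
    rw [add_sub_cancel_left, inner_smul_right, norm_smul, mul_pow, Real.norm_eq_abs, sq_abs] at h2
    refine le_of_mul_le_mul_left ?_ ht
    linarith
  rw [inner_neg_left]
  linarith

theorem proxObjective_composite (x u : Vec n) : proxObjective (composite h g) η x u
    = h u + ((g u + 1 / (2 * η) * ‖u - x‖ ^ 2 : ℝ) : EReal) := by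
  rw [proxObjective, composite, add_assoc, EReal.coe_add]

theorem IsClosedConvexProper.proxObjective_eq_coe (hh : IsClosedConvexProper h) (x : Vec n)
    {u : Vec n} (hu : h u ≠ ⊤) : proxObjective (composite h g) η x u
      = (((h u).toReal + g u + 1 / (2 * η) * ‖u - x‖ ^ 2 : ℝ) : EReal) := by
  rw [proxObjective_composite, add_assoc, EReal.coe_add ((h u).toReal), hh.coe_toReal hu]

/-- A subgradient of `h` at any one point makes the proximal objective coercive, so that lower
semicontinuity yields a minimizer on a ball that is a global one. -/
theorem IsClosedConvexProper.exists_isMin_proxObjective (hh : IsClosedConvexProper h)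
    (hτ : 0 ≤ τ) (hη : 0 < η) (hg : QuadBounds τ L g Dg) {p₀ s₀ : Vec n}
    (hs₀ : IsSubgrad h p₀ s₀) (x : Vec n) :
    ∃ p, ∀ u, proxObjective (composite h g) η x p ≤ proxObjective (composite h g) η x u := by
  set s := s₀ + Dg x with hs
  set a := (h p₀).toReal + ⟪s₀, x - p₀⟫ + g x with ha
  have hlow : ∀ u, h u ≠ ⊤ → a + ⟪s, u - x⟫ + 1 / (2 * η) * ‖u - x‖ ^ 2
      ≤ (h u).toReal + g u + 1 / (2 * η) * ‖u - x‖ ^ 2 := fun u hu => by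
    have h1 := hs₀.le u hu
    have h2 := hg.lower x u
    have h3 : ⟪s₀, u - p₀⟫ = ⟪s₀, x - p₀⟫ + ⟪s₀, u - x⟫ := by
      rw [← inner_add_right]; congr 1; abel
    have h4 : 0 ≤ τ / 2 * ‖u - x‖ ^ 2 := by positivity
    rw [hs, inner_add_left]
    linarith
  set B := (h p₀).toReal + g p₀ + 1 / (2 * η) * ‖p₀ - x‖ ^ 2 with hB
  set R := 1 + 2 * η * (‖s‖ + |B - a| + 1) with hR
  have hR1 : 1 ≤ R := by
    rw [hR]
    have : 0 ≤ 2 * η * (‖s‖ + |B - a| + 1) := by positivity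
    linarith
  -- outside the ball of radius `R` around `x` the objective exceeds its value `B` at `p₀`
  have hout : ∀ u, R < ‖u - x‖ → (B : EReal) < proxObjective (composite h g) η x u := fun u hu => by
    by_cases hu' : h u = ⊤
    · rw [proxObjective_composite, hu', EReal.top_add_coe]
      exact EReal.coe_lt_top _
    · rw [hh.proxObjective_eq_coe x hu', EReal.coe_lt_coe_iff]
      refine lt_of_lt_of_le ?_ (hlow u hu')
      have h1 : -(‖s‖ * ‖u - x‖) ≤ ⟪s, u - x⟫ := neg_le_of_abs_le (abs_real_inner_le_norm _ _)
      have h2 : ‖s‖ + |B - a| + 1 ≤ 1 / (2 * η) * ‖u - x‖ := by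
        rw [one_div, le_inv_mul_iff₀ (by positivity)]
        linarith
      have h3 : 1 * (|B - a| + 1) ≤ ‖u - x‖ * (1 / (2 * η) * ‖u - x‖ - ‖s‖) :=
        mul_le_mul (by linarith) (by linarith) (by positivity) (norm_nonneg _)
      have h4 := le_abs_self (B - a)
      nlinarith
  have hB' : proxObjective (composite h g) η x p₀ = (B : EReal) :=
    hh.proxObjective_eq_coe x hs₀.ne_top
  have hp₀ : p₀ ∈ Metric.closedBall x R := by
    rw [Metric.mem_closedBall, dist_eq_norm]
    by_contra hcon
    exact (hout p₀ (not_le.1 hcon)).ne hB'.symm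
  have hcont : Continuous fun u => g u + 1 / (2 * η) * ‖u - x‖ ^ 2 :=
    hg.continuous.add (by fun_prop)
  have hlsc : LowerSemicontinuous fun u => proxObjective (composite h g) η x u := by
    simp_rw [proxObjective_composite]
    refine hh.closed.add' (continuous_coe_real_ereal.comp hcont).lowerSemicontinuous fun u => ?_
    exact EReal.continuousAt_add (Or.inr (EReal.coe_ne_bot _)) (Or.inr (EReal.coe_ne_top _))
  obtain ⟨p, -, hp⟩ := LowerSemicontinuousOn.exists_isMinOn ⟨p₀, hp₀⟩
    (isCompact_closedBall x R) (hlsc.lowerSemicontinuousOn _)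
  refine ⟨p, fun u => ?_⟩
  by_cases hu : u ∈ Metric.closedBall x R
  · exact hp hu
  · rw [Metric.mem_closedBall, dist_eq_norm, not_le] at hu
    exact ((hp hp₀).trans hB'.le).trans (hout u hu).le

theorem IsClosedConvexProper.proxObjective_prox_le (hh : IsClosedConvexProper h)
    (hτ : 0 ≤ τ) (hη : 0 < η) (hg : QuadBounds τ L g Dg) {p₀ s₀ : Vec n}
    (hs₀ : IsSubgrad h p₀ s₀) (x u : Vec n) :
    proxObjective (composite h g) η x (prox (composite h g) η x)
      ≤ proxObjective (composite h g) η x u :=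
  Classical.epsilon_spec (hh.exists_isMin_proxObjective hτ hη hg hs₀ x) u

theorem sub_prox_eq_smul_moreauGrad (hη : 0 < η) (φ : Vec n → EReal) (x : Vec n) :
    x - prox φ η x = η • moreauGrad φ η x := by
  rw [moreauGrad, smul_inv_smul₀ hη.ne']

/-- The optimality condition of the proximal point. -/
theorem IsClosedConvexProper.isSubgrad_prox (hh : IsClosedConvexProper h)
    (hτ : 0 ≤ τ) (hη : 0 < η) (hg : QuadBounds τ L g Dg) {p₀ s₀ : Vec n}
    (hs₀ : IsSubgrad h p₀ s₀) (x : Vec n) :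
    IsSubgrad h (prox (composite h g) η x)
      (moreauGrad (composite h g) η x - Dg (prox (composite h g) η x)) := by
  set p := prox (composite h g) η x with hp
  have hmin := hh.proxObjective_prox_le hτ hη hg hs₀ x
  simp_rw [← hp, proxObjective_composite] at hmin
  have := hh.isSubgrad_of_forall_le (ψ := fun u => g u + 1 / (2 * η) * ‖u - x‖ ^ 2)
    (s := Dg p - moreauGrad (composite h g) η x)
    (c := L + 1 / (2 * η)) (fun u => ?_) hmin
  · simpa using this
  · have h1 := hg.upper p u
    have h2 : ‖u - x‖ ^ 2 = ‖u - p‖ ^ 2 + 2 * ⟪u - p, p - x⟫ + ‖p - x‖ ^ 2 := by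
      rw [← norm_add_sq_real, sub_add_sub_cancel]
    have h3 : ⟪moreauGrad (composite h g) η x, u - p⟫ = -(η⁻¹ * ⟪u - p, p - x⟫) := by
      rw [moreauGrad, ← hp, inner_smul_left, conj_trivial, ← neg_sub p x, inner_neg_left,
        real_inner_comm]
      ring
    rw [inner_sub_left, h3, h2]
    have h4 : 1 / (2 * η) * (2 * ⟪u - p, p - x⟫) = η⁻¹ * ⟪u - p, p - x⟫ := by field_simp
    linarith

/-! ### The Moreau envelope of a strongly convex function -/

theorem IsClosedConvexProper.toReal_moreauEnvelope (hh : IsClosedConvexProper h)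
    (hτ : 0 ≤ τ) (hη : 0 < η) (hg : QuadBounds τ L g Dg) {p₀ s₀ : Vec n}
    (hs₀ : IsSubgrad h p₀ s₀) (x : Vec n) :
    (moreauEnvelope (composite h g) η x).toReal
      = (h (prox (composite h g) η x)).toReal + g (prox (composite h g) η x)
        + η / 2 * ‖moreauGrad (composite h g) η x‖ ^ 2 := by
  have henv : moreauEnvelope (composite h g) η x
      = proxObjective (composite h g) η x (prox (composite h g) η x) :=
    le_antisymm (iInf_le _ _) (le_iInf (hh.proxObjective_prox_le hτ hη hg hs₀ x))
  rw [henv, hh.proxObjective_eq_coe x (hh.isSubgrad_prox hτ hη hg hs₀ x).ne_top, EReal.toReal_coe,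
    norm_sub_rev, sub_prox_eq_smul_moreauGrad hη, norm_smul, Real.norm_of_nonneg hη.le]
  field_simp

theorem IsClosedConvexProper.toReal_moreauEnvelope_le (hh : IsClosedConvexProper h)
    (hτ : 0 ≤ τ) (hη : 0 < η) (hg : QuadBounds τ L g Dg) {p₀ s₀ : Vec n}
    (hs₀ : IsSubgrad h p₀ s₀) (x : Vec n) {u : Vec n} (hu : h u ≠ ⊤) :
    (moreauEnvelope (composite h g) η x).toReal
      ≤ (h u).toReal + g u + 1 / (2 * η) * ‖u - x‖ ^ 2 := by
  have hp := (hh.isSubgrad_prox hτ hη hg hs₀ x).ne_top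
  have h1 : moreauEnvelope (composite h g) η x
      = proxObjective (composite h g) η x (prox (composite h g) η x) :=
    le_antisymm (iInf_le _ _) (le_iInf (hh.proxObjective_prox_le hτ hη hg hs₀ x))
  have h2 := hh.proxObjective_prox_le hτ hη hg hs₀ x u
  rw [← h1, hh.proxObjective_eq_coe x hu] at h2
  rw [hh.proxObjective_eq_coe x hp] at h1
  rw [h1, EReal.coe_le_coe_iff] at h2
  rwa [h1, EReal.toReal_coe]

/-- The envelope is `1/η`-smooth. -/
theorem IsClosedConvexProper.moreauEnvelope_descent (hh : IsClosedConvexProper h)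
    (hτ : 0 ≤ τ) (hη : 0 < η) (hg : QuadBounds τ L g Dg) {p₀ s₀ : Vec n}
    (hs₀ : IsSubgrad h p₀ s₀) (x v : Vec n) :
    (moreauEnvelope (composite h g) η (x + v)).toReal
      ≤ (moreauEnvelope (composite h g) η x).toReal + ⟪moreauGrad (composite h g) η x, v⟫
        + 1 / (2 * η) * ‖v‖ ^ 2 := by
  have hp := (hh.isSubgrad_prox hτ hη hg hs₀ x).ne_top
  refine (hh.toReal_moreauEnvelope_le hτ hη hg hs₀ (x + v) hp).trans_eq ?_
  rw [hh.toReal_moreauEnvelope hτ hη hg hs₀ x, norm_sub_rev, add_sub_right_comm,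
    sub_prox_eq_smul_moreauGrad hη, norm_add_sq_real, norm_smul, Real.norm_of_nonneg hη.le,
    inner_smul_left, conj_trivial]
  field_simp
  ring

/-- Strong convexity of `h + g`, at the proximal point. -/
theorem IsClosedConvexProper.add_inner_moreauGrad_le (hh : IsClosedConvexProper h)
    (hτ : 0 ≤ τ) (hη : 0 < η) (hg : QuadBounds τ L g Dg) {p₀ s₀ : Vec n}
    (hs₀ : IsSubgrad h p₀ s₀) (x : Vec n) {u : Vec n} (hu : h u ≠ ⊤) :
    (h (prox (composite h g) η x)).toReal + g (prox (composite h g) η x)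
        + ⟪moreauGrad (composite h g) η x, u - prox (composite h g) η x⟫
        + τ / 2 * ‖u - prox (composite h g) η x‖ ^ 2 ≤ (h u).toReal + g u := by
  have h1 := (hh.isSubgrad_prox hτ hη hg hs₀ x).le u hu
  have h2 := hg.lower (prox (composite h g) η x) u
  rw [inner_sub_left] at h1
  linarith

/-- Replacing `g` by another function `g'` moves the gradient of the envelope by at most the
distance of the slopes at the proximal point of `h + g`; strong monotonicity of the slope of `g'`
gains the factor `1 + ητ`. -/
theorem IsClosedConvexProper.norm_moreauGrad_sub_le (hh : IsClosedConvexProper h)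
    (hτ : 0 ≤ τ) (hη : 0 < η) (hg : QuadBounds τ L g Dg) {g' : Vec n → ℝ} {Dg' : Vec n → Vec n}
    (hg' : QuadBounds τ L g' Dg') {p₀ s₀ : Vec n} (hs₀ : IsSubgrad h p₀ s₀) (x : Vec n) :
    (1 + η * τ) * ‖moreauGrad (composite h g') η x - moreauGrad (composite h g) η x‖
      ≤ ‖Dg (prox (composite h g) η x) - Dg' (prox (composite h g) η x)‖ := by
  have hm := (hh.isSubgrad_prox hτ hη hg hs₀ x).monotone (hh.isSubgrad_prox hτ hη hg' hs₀ x)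
  set p := prox (composite h g) η x with hp
  set p' := prox (composite h g') η x with hp'
  set w := moreauGrad (composite h g') η x - moreauGrad (composite h g) η x with hw
  have hpp : p' - p = -(η • w) := by
    rw [hw, smul_sub, ← sub_prox_eq_smul_moreauGrad hη, ← sub_prox_eq_smul_moreauGrad hη]
    abel
  have hsm := hg'.strongly_monotone p p'
  have hsplit : (moreauGrad (composite h g') η x - Dg' p') - (moreauGrad (composite h g) η x - Dg p)
      = w - (Dg' p' - Dg' p) + (Dg p - Dg' p) := by rw [hw]; abel
  rw [hsplit, inner_add_left, inner_sub_left] at hm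
  have hcs := real_inner_le_norm (Dg p - Dg' p) (p' - p)
  have hww : ⟪w, p' - p⟫ = -(η * ‖w‖ ^ 2) := by
    rw [hpp, inner_neg_right, inner_smul_right, real_inner_self_eq_norm_sq]
  have hn : ‖p' - p‖ = η * ‖w‖ := by
    rw [hpp, norm_neg, norm_smul, Real.norm_of_nonneg hη.le]
  rw [hn] at hcs hsm
  rw [hww] at hm
  rcases (norm_nonneg w).eq_or_lt with h0 | h0
  · rw [← h0, mul_zero]
    exact norm_nonneg _
  · refine le_of_mul_le_mul_right ?_ (mul_pos hη h0)
    nlinarith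

section Minimizer

variable {xs : Vec n}

theorem IsClosedConvexProper.isSubgrad_of_isMin (hh : IsClosedConvexProper h)
    (hg : QuadBounds τ L g Dg) (hmin : ∀ y, composite h g xs ≤ composite h g y) :
    IsSubgrad h xs (-Dg xs) :=
  hh.isSubgrad_of_forall_le (hg.upper xs) hmin

theorem IsClosedConvexProper.quadratic_growth (hh : IsClosedConvexProper h)
    (hg : QuadBounds τ L g Dg) (hmin : ∀ y, composite h g xs ≤ composite h g y) {u : Vec n}
    (hu : h u ≠ ⊤) :
    (h xs).toReal + g xs + τ / 2 * ‖u - xs‖ ^ 2 ≤ (h u).toReal + g u := by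
  have h1 := (hh.isSubgrad_of_isMin hg hmin).le u hu
  have h2 := hg.lower xs u
  rw [inner_neg_left] at h1
  linarith

theorem IsClosedConvexProper.toReal_moreauEnvelope_minimizer (hh : IsClosedConvexProper h)
    (hτ : 0 ≤ τ) (hη : 0 < η) (hg : QuadBounds τ L g Dg)
    (hmin : ∀ y, composite h g xs ≤ composite h g y) :
    (moreauEnvelope (composite h g) η xs).toReal = (h xs).toReal + g xs := by
  have hs := hh.isSubgrad_of_isMin hg hmin
  refine le_antisymm ?_ ?_
  · simpa using hh.toReal_moreauEnvelope_le hτ hη hg hs xs hs.ne_top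
  · have h1 := hh.quadratic_growth hg hmin (hh.isSubgrad_prox hτ hη hg hs xs).ne_top
    rw [hh.toReal_moreauEnvelope hτ hη hg hs xs]
    have : 0 ≤ τ / 2 * ‖prox (composite h g) η xs - xs‖ ^ 2 := by positivity
    have : 0 ≤ η / 2 * ‖moreauGrad (composite h g) η xs‖ ^ 2 := by positivity
    linarith

theorem IsClosedConvexProper.moreauEnvelope_sub_le_sq_dist (hh : IsClosedConvexProper h)
    (hτ : 0 ≤ τ) (hη : 0 < η) (hg : QuadBounds τ L g Dg)
    (hmin : ∀ y, composite h g xs ≤ composite h g y) (x : Vec n) :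
    (moreauEnvelope (composite h g) η x).toReal - (moreauEnvelope (composite h g) η xs).toReal
      ≤ 1 / (2 * η) * ‖x - xs‖ ^ 2 := by
  have hs := hh.isSubgrad_of_isMin hg hmin
  have h1 := hh.toReal_moreauEnvelope_le hτ hη hg hs x hs.ne_top
  rw [hh.toReal_moreauEnvelope_minimizer hτ hη hg hmin, norm_sub_rev]
  linarith

/-- The envelope is strongly convex with modulus `τ / (1 + ητ)`, here in the form of quadratic
growth. The modulus is that of the infimal convolution of `τ/2 ‖·‖²` and `1/(2η) ‖·‖²`. -/
theorem IsClosedConvexProper.sq_dist_le_moreauEnvelope_sub (hh : IsClosedConvexProper h)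
    (hτ : 0 < τ) (hη : 0 < η) (hg : QuadBounds τ L g Dg)
    (hmin : ∀ y, composite h g xs ≤ composite h g y) (x : Vec n) :
    τ / (2 * (1 + η * τ)) * ‖x - xs‖ ^ 2 ≤ (moreauEnvelope (composite h g) η x).toReal
      - (moreauEnvelope (composite h g) η xs).toReal := by
  have hs := hh.isSubgrad_of_isMin hg hmin
  have h1 := hh.quadratic_growth hg hmin (hh.isSubgrad_prox hτ.le hη hg hs x).ne_top
  rw [hh.toReal_moreauEnvelope_minimizer hτ.le hη hg hmin,
    hh.toReal_moreauEnvelope hτ.le hη hg hs x]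
  have hx : x - xs = η • moreauGrad (composite h g) η x + (prox (composite h g) η x - xs) := by
    rw [← sub_prox_eq_smul_moreauGrad hη, sub_add_sub_cancel]
  have h2 : ‖x - xs‖ ≤ η * ‖moreauGrad (composite h g) η x‖ + ‖prox (composite h g) η x - xs‖ := by
    rw [hx]
    refine (norm_add_le _ _).trans_eq ?_
    rw [norm_smul, Real.norm_of_nonneg hη.le]
  set a := ‖moreauGrad (composite h g) η x‖
  set b := ‖prox (composite h g) η x - xs‖
  have h3 : ‖x - xs‖ ^ 2 ≤ (η * a + b) ^ 2 := pow_le_pow_left₀ (norm_nonneg _) h2 2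
  have hpos : 0 < 1 + η * τ := by positivity
  have h4 : τ / (2 * (1 + η * τ)) * (η * a + b) ^ 2 ≤ τ / 2 * b ^ 2 + η / 2 * a ^ 2 := by
    rw [div_mul_eq_mul_div, div_le_iff₀ (by positivity)]
    nlinarith [mul_nonneg hη.le (sq_nonneg (a - τ * b))]
  have h5 := mul_le_mul_of_nonneg_left h3 (by positivity : 0 ≤ τ / (2 * (1 + η * τ)))
  linarith

/-- The Polyak–Łojasiewicz inequality for the envelope. -/
theorem IsClosedConvexProper.moreauEnvelope_sub_le_sq_norm_moreauGrad
    (hh : IsClosedConvexProper h)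
    (hτ : 0 < τ) (hη : 0 < η) (hg : QuadBounds τ L g Dg)
    (hmin : ∀ y, composite h g xs ≤ composite h g y) (x : Vec n) :
    (moreauEnvelope (composite h g) η x).toReal - (moreauEnvelope (composite h g) η xs).toReal
      ≤ (1 + η * τ) / (2 * τ) * ‖moreauGrad (composite h g) η x‖ ^ 2 := by
  have hs := hh.isSubgrad_of_isMin hg hmin
  have h1 := hh.add_inner_moreauGrad_le hτ.le hη hg hs x hs.ne_top
  rw [hh.toReal_moreauEnvelope_minimizer hτ.le hη hg hmin,
    hh.toReal_moreauEnvelope hτ.le hη hg hs x]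
  set G := moreauGrad (composite h g) η x
  set v := xs - prox (composite h g) η x
  have h2 : -(‖G‖ * ‖v‖) ≤ ⟪G, v⟫ := neg_le_of_abs_le (abs_real_inner_le_norm _ _)
  have h3 : ‖G‖ * ‖v‖ ≤ 1 / (2 * τ) * ‖G‖ ^ 2 + τ / 2 * ‖v‖ ^ 2 := by
    have : 1 / (2 * τ) * ‖G‖ ^ 2 + τ / 2 * ‖v‖ ^ 2 - ‖G‖ * ‖v‖
        = 1 / (2 * τ) * (‖G‖ - τ * ‖v‖) ^ 2 := by field_simp; ring
    have : 0 ≤ 1 / (2 * τ) * (‖G‖ - τ * ‖v‖) ^ 2 := by positivity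
    linarith
  have h4 : (1 + η * τ) / (2 * τ) * ‖G‖ ^ 2 = 1 / (2 * τ) * ‖G‖ ^ 2 + η / 2 * ‖G‖ ^ 2 := by
    field_simp
  linarith

theorem IsClosedConvexProper.norm_moreauGrad_le (hh : IsClosedConvexProper h)
    (hτ : 0 ≤ τ) (hη : 0 < η) (hg : QuadBounds τ L g Dg)
    (hmin : ∀ y, composite h g xs ≤ composite h g y) (x : Vec n) :
    η * ‖moreauGrad (composite h g) η x‖ ≤ ‖x - xs‖ := by
  have hs := hh.isSubgrad_of_isMin hg hmin
  have h1 := hh.add_inner_moreauGrad_le hτ hη hg hs x hs.ne_top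
  have h2 := hh.quadratic_growth hg hmin (hh.isSubgrad_prox hτ hη hg hs x).ne_top
  have hx : x - xs = η • moreauGrad (composite h g) η x + (prox (composite h g) η x - xs) := by
    rw [← sub_prox_eq_smul_moreauGrad hη, sub_add_sub_cancel]
  set G := moreauGrad (composite h g) η x
  set v := prox (composite h g) η x - xs with hv
  have h3 : ⟪G, xs - prox (composite h g) η x⟫ = -⟪G, v⟫ := by
    rw [hv, ← inner_neg_right, neg_sub]
  have h4 : 0 ≤ τ / 2 * ‖xs - prox (composite h g) η x‖ ^ 2 := by positivity
  have h5 : 0 ≤ τ / 2 * ‖v‖ ^ 2 := by positivity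
  refine le_of_sq_le_sq ?_ (norm_nonneg _)
  rw [hx, norm_add_sq_real, norm_smul, Real.norm_of_nonneg hη.le, inner_smul_left, conj_trivial]
  have h6 : 0 ≤ η * ⟪G, v⟫ := mul_nonneg hη.le (by linarith)
  nlinarith [sq_nonneg ‖v‖]

end Minimizer

/-- An infimum of continuous functions is upper semicontinuous; here this follows from the descent
inequality. -/
theorem IsClosedConvexProper.measurable_toReal_moreauEnvelope (hh : IsClosedConvexProper h)
    (hτ : 0 ≤ τ) (hη : 0 < η) (hg : QuadBounds τ L g Dg) {p₀ s₀ : Vec n}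
    (hs₀ : IsSubgrad h p₀ s₀) :
    Measurable fun x => (moreauEnvelope (composite h g) η x).toReal := by
  refine UpperSemicontinuous.measurable fun x c hc => ?_
  have hcont : Continuous fun y => (moreauEnvelope (composite h g) η x).toReal
      + ⟪moreauGrad (composite h g) η x, y - x⟫ + 1 / (2 * η) * ‖y - x‖ ^ 2 := by fun_prop
  have hlt := (hcont.tendsto x).eventually_lt_const (u := c) (by simpa using hc)
  filter_upwards [hlt] with y hy
  have := hh.moreauEnvelope_descent hτ hη hg hs₀ x (y - x)
  rw [add_sub_cancel] at this
  exact this.trans_lt hy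

end Envelope

/-! ### One step of the quasi-Newton scheme -/

/-- A symmetric operator with `lo ‖v‖² ≤ ⟪v, T v⟫ ≤ hi ‖v‖²`. -/
structure SymmBounds {n : ℕ} (lo hi : ℝ) (T : Vec n →ₗ[ℝ] Vec n) : Prop where
  symm : ∀ v w, ⟪T v, w⟫ = ⟪v, T w⟫
  lower : ∀ v, lo * ‖v‖ ^ 2 ≤ ⟪v, T v⟫
  upper : ∀ v, ⟪v, T v⟫ ≤ hi * ‖v‖ ^ 2

theorem SymmBounds.of_matrix {n : ℕ} {lo hi : ℝ} {A : Matrix (Fin n) (Fin n) ℝ} (hA : A.PosDef)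
    (hlo : (A - lo • (1 : Matrix (Fin n) (Fin n) ℝ)).PosSemidef)
    (hhi : (hi • (1 : Matrix (Fin n) (Fin n) ℝ) - A).PosSemidef) :
    SymmBounds lo hi (Matrix.toEuclideanLin A) := by
  have h1 : ∀ v : Vec n, Matrix.toEuclideanLin (1 : Matrix (Fin n) (Fin n) ℝ) v = v := fun v => by
    simp
  have hA' := Matrix.isPositive_toEuclideanLin_iff.2 hA.posSemidef
  have hlo' := Matrix.isPositive_toEuclideanLin_iff.2 hlo
  have hhi' := Matrix.isPositive_toEuclideanLin_iff.2 hhi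
  refine ⟨fun v w => hA'.isSymmetric v w, fun v => ?_, fun v => ?_⟩
  · have := hlo'.re_inner_nonneg_right v
    simp only [map_sub, map_smul, LinearMap.sub_apply, LinearMap.smul_apply, h1, inner_sub_right,
      inner_smul_right, real_inner_self_eq_norm_sq, RCLike.re_to_real] at this
    linarith
  · have := hhi'.re_inner_nonneg_right v
    simp only [map_sub, map_smul, LinearMap.sub_apply, LinearMap.smul_apply, h1, inner_sub_right,
      inner_smul_right, real_inner_self_eq_norm_sq, RCLike.re_to_real] at this
    linarith

namespace SymmBounds

variable {n : ℕ} {lo hi : ℝ} {T : Vec n →ₗ[ℝ] Vec n}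

theorem inner_nonneg (hT : SymmBounds lo hi T) (hlo : 0 ≤ lo) (v : Vec n) : 0 ≤ ⟪v, T v⟫ :=
  (by positivity : 0 ≤ lo * ‖v‖ ^ 2).trans (hT.lower v)

theorem inner_add (hT : SymmBounds lo hi T) (v w : Vec n) :
    ⟪v + w, T (v + w)⟫ = ⟪v, T v⟫ + 2 * ⟪v, T w⟫ + ⟪w, T w⟫ := by
  have : ⟪w, T v⟫ = ⟪v, T w⟫ := by rw [real_inner_comm, hT.symm]
  rw [map_add, inner_add_left, inner_add_right, inner_add_right, this]
  ring

theorem sq_norm_le (hT : SymmBounds lo hi T) (hlo : 0 ≤ lo) (hhi : 0 < hi) (v : Vec n) :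
    ‖T v‖ ^ 2 ≤ hi * ⟪v, T v⟫ := by
  -- positivity at `v - hi⁻¹ T v`
  have h1 := hT.inner_nonneg hlo (v + (-hi⁻¹) • T v)
  have h2 := hT.upper (T v)
  rw [hT.inner_add, map_smul, inner_smul_right, inner_smul_right, inner_smul_left, ← hT.symm v (T v),
    real_inner_self_eq_norm_sq, conj_trivial] at h1
  have h3 : hi⁻¹ * (hi⁻¹ * ⟪T v, T (T v)⟫) ≤ hi⁻¹ * ‖T v‖ ^ 2 := by
    refine mul_le_mul_of_nonneg_left ?_ (by positivity)
    rwa [inv_mul_le_iff₀ hhi]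
  rw [← inv_mul_le_iff₀ hhi]
  linarith

theorem norm_le (hT : SymmBounds lo hi T) (hlo : 0 ≤ lo) (hhi : 0 < hi) (v : Vec n) :
    ‖T v‖ ≤ hi * ‖v‖ := by
  refine le_of_sq_le_sq ?_ (by positivity)
  have h1 := mul_le_mul_of_nonneg_left (hT.upper v) hhi.le
  have h2 := hT.sq_norm_le hlo hhi v
  rw [mul_pow, pow_two hi, mul_assoc]
  exact h2.trans h1

end SymmBounds

section Step

variable {n : ℕ} {h : Vec n → EReal} {g : Vec n → ℝ} {Dg : Vec n → Vec n} {τ L η γ lo hi : ℝ}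
  {xs : Vec n} {T : Vec n →ₗ[ℝ] Vec n}

/-- The steplength `γ` with `γ hi = η / 4` makes the second-order term of the descent inequality at
most `γ/8 ⟪e, T e⟫` for the search direction `T e`, `e = ∇f_η(x) + w`. The cross terms in `w` are
then absorbed by positivity of `T`. -/
theorem IsClosedConvexProper.moreauEnvelope_step_le (hh : IsClosedConvexProper h)
    (hτ : 0 ≤ τ) (hη : 0 < η) (hg : QuadBounds τ L g Dg) {p₀ s₀ : Vec n}
    (hs₀ : IsSubgrad h p₀ s₀) (hT : SymmBounds lo hi T) (hlo : 0 ≤ lo) (hhi : 0 < hi)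
    (hγ : γ * hi = η / 4) (x w : Vec n) :
    (moreauEnvelope (composite h g) η (x - γ • T (moreauGrad (composite h g) η x + w))).toReal
      ≤ (moreauEnvelope (composite h g) η x).toReal
        - γ * lo / 2 * ‖moreauGrad (composite h g) η x‖ ^ 2 + η / 8 * ‖w‖ ^ 2 := by
  have hγ0 : 0 < γ := pos_of_mul_pos_left (hγ ▸ by positivity) hhi.le
  set G := moreauGrad (composite h g) η x with hG
  have h1 := hh.moreauEnvelope_descent hτ hη hg hs₀ x (-(γ • T (G + w)))
  rw [← sub_eq_add_neg, ← hG, inner_neg_right, inner_smul_right, norm_neg, norm_smul, mul_pow,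
    Real.norm_of_nonneg hγ0.le] at h1
  have h2 : 1 / (2 * η) * (γ ^ 2 * ‖T (G + w)‖ ^ 2) ≤ γ / 8 * ⟪G + w, T (G + w)⟫ := by
    have := mul_le_mul_of_nonneg_left (hT.sq_norm_le hlo hhi (G + w))
      (by positivity : 0 ≤ 1 / (2 * η) * γ ^ 2)
    calc _ = 1 / (2 * η) * γ ^ 2 * ‖T (G + w)‖ ^ 2 := by ring
      _ ≤ 1 / (2 * η) * γ ^ 2 * (hi * ⟪G + w, T (G + w)⟫) := this
      _ = 1 / (2 * η) * γ * (γ * hi) * ⟪G + w, T (G + w)⟫ := by ring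
      _ = _ := by rw [hγ]; field_simp; ring
  have h3 := hT.inner_nonneg hlo (G + w)
  rw [hT.inner_add] at h2 h3
  have hGT : ⟪G, T (G + w)⟫ = ⟪G, T G⟫ + ⟪G, T w⟫ := by rw [map_add, inner_add_right]
  rw [hGT] at h1
  have h4 := mul_le_mul_of_nonneg_left h3 hγ0.le
  have h5 := mul_le_mul_of_nonneg_left (hT.lower G) hγ0.le
  have h6 := mul_le_mul_of_nonneg_left (hT.upper w) hγ0.le
  rw [← mul_assoc, hγ] at h6
  linarith

theorem IsClosedConvexProper.norm_step_le (hh : IsClosedConvexProper h)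
    (hτ : 0 ≤ τ) (hη : 0 < η) (hg : QuadBounds τ L g Dg)
    (hmin : ∀ y, composite h g xs ≤ composite h g y) (hT : SymmBounds lo hi T)
    (hlo : 0 ≤ lo) (hhi : 0 < hi) (hγ : γ * hi = η / 4) (x w : Vec n) :
    ‖x - γ • T (moreauGrad (composite h g) η x + w) - xs‖
      ≤ 5 / 4 * ‖x - xs‖ + η / 4 * ‖w‖ := by
  have hγ0 : 0 < γ := pos_of_mul_pos_left (hγ ▸ by positivity) hhi.le
  have hG := hh.norm_moreauGrad_le hτ hη hg hmin x
  set G := moreauGrad (composite h g) η x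
  have h1 : ‖x - γ • T (G + w) - xs‖ ≤ ‖x - xs‖ + γ * ‖T (G + w)‖ := by
    rw [sub_right_comm]
    refine (norm_sub_le _ _).trans_eq ?_
    rw [norm_smul, Real.norm_of_nonneg hγ0.le]
  have h2 := mul_le_mul_of_nonneg_left (hT.norm_le hlo hhi (G + w)) hγ0.le
  rw [← mul_assoc, hγ] at h2
  have h3 := mul_le_mul_of_nonneg_left (norm_add_le G w) (by positivity : 0 ≤ η / 4)
  linarith

end Step

/-! ### Perturbed linear recursions and complexity -/

/-- The recursion unrolls to `a₀ dᵏ + B (qᵏ - dᵏ) / (q - d)`. -/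
theorem le_mul_max_pow_of_le_mul_add {a : ℕ → ℝ} {d q B : ℝ} (hd : 0 ≤ d) (hq : 0 ≤ q)
    (hqd : q ≠ d) (hB : 0 ≤ B) (ha0 : 0 ≤ a 0) (ha : ∀ k, a (k + 1) ≤ d * a k + B * q ^ k) (k : ℕ) :
    a k ≤ (a 0 + B / (max q d - min q d)) * max q d ^ k := by
  have hne : q - d ≠ 0 := sub_ne_zero.2 hqd
  have hclosed : ∀ k, a k ≤ a 0 * d ^ k + B * ((q ^ k - d ^ k) / (q - d)) := fun k => by
    induction k with
    | zero => simp
    | succ k ih =>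
      calc a (k + 1) ≤ d * a k + B * q ^ k := ha k
        _ ≤ d * (a 0 * d ^ k + B * ((q ^ k - d ^ k) / (q - d))) + B * q ^ k := by gcongr
        _ = _ := by field_simp; ring
  refine (hclosed k).trans ?_
  rw [add_mul, div_mul_eq_mul_div, mul_div_assoc]
  refine add_le_add (by gcongr; exact le_max_right q d) (mul_le_mul_of_nonneg_left ?_ hB)
  rcases hqd.lt_or_gt with hlt | hlt
  · rw [max_eq_right hlt.le, min_eq_left hlt.le, ← neg_div_neg_eq, neg_sub, neg_sub]
    have : 0 < d - q := sub_pos.2 hlt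
    have : 0 ≤ q ^ k := by positivity
    gcongr
    linarith
  · rw [max_eq_left hlt.le, min_eq_right hlt.le]
    have : 0 < q - d := sub_pos.2 hlt
    have : 0 ≤ d ^ k := by positivity
    gcongr
    linarith

/-- The first `K` with `M c ^ (K + 1) ≤ ε` is of order `ln(1/ε)`, and `c ^ K` has not yet fallen
below `ε / M`. -/
theorem exists_pow_le_of_le_log {c M : ℝ} (hc0 : 0 < c) (hc1 : c < 1) (hM : 1 ≤ M) :
    ∃ C : ℝ, 0 < C ∧ ∀ ε : ℝ, 0 < ε → ε ≤ 1 / 2 → ∃ K : ℕ, M * c ^ (K + 1) ≤ ε ∧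
      (K : ℝ) + 1 ≤ C * Real.log (1 / ε) ∧ (c ^ K)⁻¹ ≤ M / ε := by
  have hM0 : 0 < M := by linarith
  have hlc : 0 < Real.log (1 / c) := Real.log_pos ((one_lt_div hc0).2 hc1)
  have hl2 : 0 < Real.log 2 := Real.log_pos one_lt_two
  have hlM : 0 ≤ Real.log M := Real.log_nonneg hM
  refine ⟨(Real.log M / Real.log 2 + 1) / Real.log (1 / c) + 1 / Real.log 2, by positivity,
    fun ε hε hε2 => ?_⟩
  have hex : ∃ m : ℕ, M * c ^ m ≤ ε := by
    obtain ⟨m, hm⟩ := exists_pow_lt_of_lt_one (div_pos hε hM0) hc1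
    exact ⟨m, by rw [mul_comm]; exact ((lt_div_iff₀ hM0).1 hm).le⟩
  classical
  obtain ⟨K, hK⟩ : ∃ K, Nat.find hex = K + 1 := by
    refine Nat.exists_eq_succ_of_ne_zero fun h0 => ?_
    have := Nat.find_spec hex
    rw [h0, pow_zero, mul_one] at this
    linarith
  have hlt : ε < M * c ^ K := not_le.1 (Nat.find_min hex (by omega))
  have hpow : (c ^ K)⁻¹ ≤ M / ε := by
    rw [inv_le_iff_one_le_mul₀ (by positivity), div_mul_eq_mul_div, one_le_div hε]
    exact hlt.le
  have hlog : Real.log 2 ≤ Real.log (1 / ε) :=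
    Real.log_le_log two_pos (by rw [le_div_iff₀ hε]; linarith)
  refine ⟨K, hK ▸ Nat.find_spec hex, ?_, hpow⟩
  have h1 : K * Real.log (1 / c) ≤ Real.log M + Real.log (1 / ε) := by
    rw [← Real.log_pow, ← Real.log_mul hM0.ne' (by positivity)]
    refine Real.log_le_log (by positivity) ?_
    rw [one_div, inv_pow, mul_one_div]
    exact hpow
  have h2 : Real.log M ≤ Real.log M / Real.log 2 * Real.log (1 / ε) := by
    rw [div_mul_eq_mul_div, le_div_iff₀ hl2]
    exact mul_le_mul_of_nonneg_left hlog hlM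
  have h3 : 1 ≤ 1 / Real.log 2 * Real.log (1 / ε) := by
    rw [div_mul_eq_mul_div, one_mul, one_le_div hl2]
    exact hlog
  have h4 : (K : ℝ) ≤ (Real.log M / Real.log 2 + 1) / Real.log (1 / c) * Real.log (1 / ε) := by
    rw [div_mul_eq_mul_div, le_div_iff₀ hlc]
    linarith
  linarith

theorem batchSize_pos {N₀ : ℕ} (hN₀ : 0 < N₀) {q : ℝ} (hq : 0 < q) (k : ℕ) :
    0 < batchSize N₀ q k := by
  have : (0 : ℝ) < N₀ := by exact_mod_cast hN₀
  exact Nat.ceil_pos.2 (by positivity)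

theorem one_div_batchSize_le {N₀ : ℕ} (hN₀ : 0 < N₀) {q : ℝ} (hq : 0 < q) (k : ℕ) :
    1 / (batchSize N₀ q k : ℝ) ≤ q ^ k / N₀ := by
  have : (0 : ℝ) < N₀ := by exact_mod_cast hN₀
  have h1 : (N₀ : ℝ) * (q ^ k)⁻¹ ≤ batchSize N₀ q k := Nat.le_ceil _
  refine (one_div_le_one_div_of_le (by positivity) h1).trans_eq ?_
  field_simp

theorem sum_batchSize_le (N₀ : ℕ) {q : ℝ} (hq0 : 0 < q) (hq1 : q < 1) (K : ℕ) :
    ∑ k ∈ Finset.range (K + 1), (batchSize N₀ q k : ℝ) ≤ ((N₀ : ℝ) + 1) / (1 - q) * (q ^ K)⁻¹ := by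
  have hb : ∀ k, (batchSize N₀ q k : ℝ) ≤ ((N₀ : ℝ) + 1) * (q ^ k)⁻¹ := fun k => by
    have h1 : (batchSize N₀ q k : ℝ) < (N₀ : ℝ) * (q ^ k)⁻¹ + 1 := Nat.ceil_lt_add_one (by positivity)
    have h2 : 1 ≤ (q ^ k)⁻¹ := (one_le_inv₀ (by positivity)).2 (pow_le_one₀ hq0.le hq1.le)
    linarith
  have h1q : 0 < 1 - q := sub_pos.2 hq1
  induction K with
  | zero =>
    rw [zero_add, Finset.sum_range_one]
    refine (hb 0).trans (mul_le_mul_of_nonneg_right ?_ (by simp))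
    rw [le_div_iff₀ h1q]
    nlinarith
  | succ K ih =>
    rw [Finset.sum_range_succ]
    refine (add_le_add ih (hb (K + 1))).trans_eq ?_
    rw [pow_succ]
    field_simp
    ring

/-! ### Expectations along the scheme -/

section Parameters

variable {n : ℕ} {τ η γ d : ℝ}

/-- The bound on `η` keeps the contraction factor nonnegative. -/
theorem contraction_factor_bounds (hτ : 0 < τ) (hη : 0 < η)
    (hη_le : η ≤ (4 * ((n : ℝ) + 1) ^ 2 / τ ^ 2) ^ ((1 : ℝ) / 3))
    (hd : d = 1 - τ ^ 2 * η ^ 3 / (4 * ((n : ℝ) + 1) ^ 2 * (1 + η * τ))) : 0 ≤ d ∧ d < 1 := by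
  have hcube : η ^ 3 ≤ 4 * ((n : ℝ) + 1) ^ 2 / τ ^ 2 := by
    refine (pow_le_pow_left₀ hη.le hη_le 3).trans_eq ?_
    rw [← Real.rpow_natCast, ← Real.rpow_mul (by positivity)]
    norm_num
  have hητ : 0 < η * τ := by positivity
  have hle : τ ^ 2 * η ^ 3 / (4 * ((n : ℝ) + 1) ^ 2 * (1 + η * τ)) ≤ 1 := by
    rw [div_le_one (by positivity)]
    rw [le_div_iff₀ (by positivity)] at hcube
    have : 0 ≤ 4 * ((n : ℝ) + 1) ^ 2 * (η * τ) := by positivity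
    linarith
  have hpos : 0 < τ ^ 2 * η ^ 3 / (4 * ((n : ℝ) + 1) ^ 2 * (1 + η * τ)) := by positivity
  constructor <;> linarith

theorem steplength_mul_hi (hτ : 0 < τ) (hη : 0 < η) (hγ : γ = τ * η ^ 2 / (4 * (1 + (n : ℝ)))) :
    γ * (((n : ℝ) + 1) / (η * τ)) = η / 4 := by
  rw [hγ, add_comm (n : ℝ)]
  field_simp

/-- Combined with the Polyak–Łojasiewicz inequality, the decrease of one step gives the factor
`d`. -/
theorem steplength_mul_lo (hτ : 0 < τ) (hη : 0 < η) (hγ : γ = τ * η ^ 2 / (4 * (1 + (n : ℝ))))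
    (hd : d = 1 - τ ^ 2 * η ^ 3 / (4 * ((n : ℝ) + 1) ^ 2 * (1 + η * τ))) :
    (1 - d) * ((1 + η * τ) / (2 * τ)) = γ * (η / ((n : ℝ) + 1)) / 2 := by
  rw [hγ, hd, add_comm (1 : ℝ) (n : ℝ)]
  have : 0 < 1 + η * τ := by positivity
  field_simp
  ring

end Parameters

section Step

variable {n : ℕ} {h : Vec n → EReal} {g : Vec n → ℝ} {Dg : Vec n → Vec n} {τ L η γ d lo hi : ℝ}
  {xs : Vec n} {T : Vec n →ₗ[ℝ] Vec n}

theorem IsClosedConvexProper.moreauEnvelope_sub_step_le (hh : IsClosedConvexProper h)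
    (hτ : 0 < τ) (hη : 0 < η) (hg : QuadBounds τ L g Dg)
    (hmin : ∀ y, composite h g xs ≤ composite h g y) (hT : SymmBounds lo hi T) (hlo : 0 ≤ lo)
    (hhi : 0 < hi) (hγ : γ * hi = η / 4) (hd1 : d ≤ 1)
    (hγd : (1 - d) * ((1 + η * τ) / (2 * τ)) = γ * lo / 2) (x w : Vec n) :
    (moreauEnvelope (composite h g) η (x - γ • T (moreauGrad (composite h g) η x + w))).toReal
        - (moreauEnvelope (composite h g) η xs).toReal
      ≤ d * ((moreauEnvelope (composite h g) η x).toReal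
          - (moreauEnvelope (composite h g) η xs).toReal) + η / 8 * ‖w‖ ^ 2 := by
  have h1 := hh.moreauEnvelope_step_le hτ.le hη hg (hh.isSubgrad_of_isMin hg hmin) hT hlo hhi hγ x w
  have h2 := mul_le_mul_of_nonneg_left
    (hh.moreauEnvelope_sub_le_sq_norm_moreauGrad hτ hη hg hmin x) (sub_nonneg.2 hd1)
  rw [← mul_assoc, hγd] at h2
  linarith

end Step

section Scheme

variable {n : ℕ} {Ω Ξ : Type*} [mΩ : MeasurableSpace Ω] [MeasurableSpace Ξ]
  {P : Measure Ω} {𝒟 : Measure Ξ} {h : Vec n → EReal} {F : Vec n → Ξ → ℝ} {τ L η ν : ℝ}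
  {ℱ : Filtration ℕ mΩ} {z : ℕ → ℕ → Ω → Ξ} {x : ℕ → Ω → Vec n} {xs : Vec n} {N : ℕ → ℕ}

/-- The batch error in the gradient of the envelope is controlled by the sampling error at the
proximal point. -/
theorem norm_gradError_le (hh : IsClosedConvexProper h) (hτ : 0 < τ) (hη : 0 < η)
    {Dg : Vec n → Vec n} (hg : QuadBounds τ L (expectedValue F 𝒟) Dg)
    (hF : ∀ y, QuadBounds τ L (fun x => F x y) (gradient fun x => F x y))
    (hmin : ∀ y, composite h (expectedValue F 𝒟) xs ≤ composite h (expectedValue F 𝒟) y)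
    {M : ℕ} (hM : 0 < M) (ζ : ℕ → Ξ) (y : Vec n) :
    (1 + η * τ) * ‖gradError h F 𝒟 η M ζ y‖
      ≤ ‖samplingError F 𝒟 M ζ (prox (composite h (expectedValue F 𝒟)) η y)‖ := by
  have := hh.norm_moreauGrad_sub_le hτ.le hη hg (QuadBounds.sampleAverage hF hM ζ)
    (hh.isSubgrad_of_isMin hg hmin) y
  rwa [← hg.gradient_eq] at this

theorem SamplingMomentBound.integral_le [IsProbabilityMeasure P]
    (hu : SamplingMomentBound P ℱ h F 𝒟 η ν N z x) (k : ℕ) :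
    ∫ ω, ‖samplingError F 𝒟 (N k) (fun j => z k j ω)
      (prox (composite h (expectedValue F 𝒟)) η (x k ω))‖ ^ 2 ∂P ≤ ν ^ 2 / (N k : ℝ) := by
  rw [← integral_condExp (ℱ.le k)]
  refine (integral_mono_ae integrable_condExp (integrable_const _) (hu k).2).trans_eq ?_
  simp

end Scheme

end MoreauSQN

theorem mainTheorem5
    {n : ℕ} {Ω Ξ : Type*} [mΩ : MeasurableSpace Ω] [MeasurableSpace Ξ]
    (P : Measure Ω) [IsProbabilityMeasure P] (𝒟 : Measure Ξ) [IsProbabilityMeasure 𝒟]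
    -- the problem: `f = h + g`, `g = E[F(·, z)]`, with minimizer `xstar`
    (h : Vec n → EReal) (hh : IsClosedConvexProper h)
    (F : Vec n → Ξ → ℝ) (hFint : ∀ x, Integrable (F x) 𝒟)
    (τ L : ℝ) (hτ : 0 < τ) (hL : 0 < L)
    (hFconv : ∀ z, StrongConvexOn univ τ fun x => F x z)
    (hFsmooth : ∀ z, IsLSmooth L fun x => F x z)
    (f : Vec n → EReal) (hf : f = composite h (expectedValue F 𝒟))
    (xstar : Vec n) (hxstar : ∀ y, f xstar ≤ f y)
    -- the parameters
    (η : ℝ) (hη : 0 < η)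
    (hη_le : η ≤ min (2 / L) ((4 * ((n : ℝ) + 1) ^ 2 / τ ^ 2) ^ ((1 : ℝ) / 3)))
    (N₀ : ℕ) (hN₀ : 0 < N₀) (q : ℝ) (hq0 : 0 < q) (hq1 : q < 1)
    (ν : ℝ) (hν : 0 < ν)
    (γ d c₁ c₂ ν₁ : ℝ)
    (hγ : γ = τ * η ^ 2 / (4 * (1 + (n : ℝ))))
    (hd : d = 1 - τ ^ 2 * η ^ 3 / (4 * ((n : ℝ) + 1) ^ 2 * (1 + η * τ)))
    (hc₁ : c₁ = max q d) (hc₂ : c₂ = min q d) (hqd : q ≠ d)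
    (hν₁ : ν₁ = ν / (η * τ))
    -- the samples `ω_{j,k} = z k j`, the scheme and its standing assumptions
    (ℱ : Filtration ℕ mΩ)
    (z : ℕ → ℕ → Ω → Ξ) (hz : ∀ k j, MeasurePreserving (z k j) P 𝒟)
    (H : ℕ → Ω → Matrix (Fin n) (Fin n) ℝ)
    (x : ℕ → Ω → Vec n) (hx_meas : ∀ k, AEStronglyMeasurable (x k) P) (hx0 : MemLp (x 0) 2 P)
    (hx : IsSVSSQN P h F 𝒟 η γ (batchSize N₀ q) z H x)
    (hH : HessianApprox P ℱ (η / ((n : ℝ) + 1)) (((n : ℝ) + 1) / (η * τ)) H)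
    (hu : SamplingMomentBound P ℱ h F 𝒟 η ν (batchSize N₀ q) z x)
    -- the constant of the linear rate
    (D : ℝ)
    (hD : D = 2 * (∫ ω, ((moreauEnvelope f η (x 0 ω)).toReal
                - (moreauEnvelope f η xstar).toReal) ∂P) * (1 + η * τ) / τ
              + 5 * (1 + η * τ) * η * ν₁ ^ 2 / (8 * τ * (N₀ : ℝ) * (c₁ - c₂))) :
    -- (i) linear rate of convergence in mean square
    (∀ k : ℕ, Integrable (fun ω => ‖x (k + 1) ω - xstar‖ ^ 2) P ∧
      ∫ ω, ‖x (k + 1) ω - xstar‖ ^ 2 ∂P ≤ D * c₁ ^ (k + 1)) ∧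
    -- (ii) iteration complexity `O(ln(1/ε))` and, for `d < q`, oracle complexity `O(1/ε)`
    (∃ C : ℝ, 0 < C ∧ ∀ ε : ℝ, 0 < ε → ε ≤ 1 / 2 →
      ∃ K : ℕ, ∫ ω, ‖x (K + 1) ω - xstar‖ ^ 2 ∂P ≤ ε ∧
        Integrable (fun ω => (moreauEnvelope f η (x (K + 1) ω)).toReal) P ∧
        ∫ ω, ((moreauEnvelope f η (x (K + 1) ω)).toReal
          - (moreauEnvelope f η xstar).toReal) ∂P ≤ ε ∧
        ((K : ℝ) + 1) ≤ C * Real.log (1 / ε) ∧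
        (d < q → ∑ k ∈ Finset.range (K + 1), (batchSize N₀ q k : ℝ) ≤ C / ε)) := by
  have hη2 := (le_min_iff.1 hη_le).2
  obtain ⟨hd0, hd1⟩ := contraction_factor_bounds hτ hη hη2 hd
  have hγhi := steplength_mul_hi (n := n) hτ hη hγ
  have hγd := steplength_mul_lo (n := n) hτ hη hγ hd
  have hN₀' : (0 : ℝ) < N₀ := by exact_mod_cast hN₀
  have hητ : 0 < 1 + η * τ := by positivity
  have hF : ∀ y, QuadBounds τ L (fun x => F x y) (gradient fun x => F x y) := fun y =>
    .of_strongConvexOn_of_isLSmooth hτ.le (hFconv y) (hFsmooth y)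
  obtain ⟨Dg, hg⟩ := QuadBounds.expectedValue hFint hF
  rw [hf] at hxstar
  have hs := hh.isSubgrad_of_isMin hg hxstar
  set φ : Vec n → ℝ := fun y => (moreauEnvelope f η y).toReal - (moreauEnvelope f η xstar).toReal
    with hφ
  have hφ_lower : ∀ y, τ / (2 * (1 + η * τ)) * ‖y - xstar‖ ^ 2 ≤ φ y := fun y => by
    rw [hφ, hf]; exact hh.sq_dist_le_moreauEnvelope_sub hτ hη hg hxstar y
  have hφ_nonneg : ∀ y, 0 ≤ φ y := fun y => le_trans (by positivity) (hφ_lower y)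
  have hφ_upper : ∀ y, φ y ≤ 1 / (2 * η) * ‖y - xstar‖ ^ 2 := fun y => by
    rw [hφ, hf]; exact hh.moreauEnvelope_sub_le_sq_dist hτ.le hη hg hxstar y
  have hφ_meas : Measurable φ := by
    rw [hφ, hf]; exact (hh.measurable_toReal_moreauEnvelope hτ.le hη hg hs).sub_const _
  set U : ℕ → Ω → ℝ := fun k ω => ‖samplingError F 𝒟 (batchSize N₀ q k) (fun j => z k j ω)
    (prox (composite h (expectedValue F 𝒟)) η (x k ω))‖ with hU
  have hU_int : ∀ k, Integrable (fun ω => U k ω ^ 2) P := fun k => (hu k).1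
  -- the two estimates of a step, with the batch error replaced by the sampling error
  have hstep : ∀ k, ∀ᵐ ω ∂P,
      φ (x (k + 1) ω) ≤ d * φ (x k ω) + η / (8 * (η * τ) ^ 2) * U k ω ^ 2 ∧
      ‖x (k + 1) ω - xstar‖ ≤ 5 / 4 * ‖x k ω - xstar‖ + η / 4 * U k ω := fun k => by
    filter_upwards [hx k, (hH k).2] with ω hxω hHω
    have hT := SymmBounds.of_matrix hHω.1 hHω.2.1 hHω.2.2
    have hlo : 0 ≤ η / ((n : ℝ) + 1) := by positivity
    have hhi : 0 < ((n : ℝ) + 1) / (η * τ) := by positivity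
    have hw := norm_gradError_le hh hτ hη hg hF hxstar (batchSize_pos hN₀ hq0 k)
      (fun j => z k j ω) (x k ω)
    have h1 := hh.moreauEnvelope_sub_step_le hτ hη hg hxstar hT hlo hhi hγhi hd1.le hγd (x k ω)
      (gradError h F 𝒟 η (batchSize N₀ q k) (fun j => z k j ω) (x k ω))
    have h2 := hh.norm_step_le hτ.le hη hg hxstar hT hlo hhi hγhi (x k ω)
      (gradError h F 𝒟 η (batchSize N₀ q k) (fun j => z k j ω) (x k ω))
    rw [← hxω] at h1 h2
    set w := ‖gradError h F 𝒟 η (batchSize N₀ q k) (fun j => z k j ω) (x k ω)‖ with hw_def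
    have hw0 : 0 ≤ w := norm_nonneg _
    have hητ' : 0 < η * τ := by positivity
    have hwU : η * τ * w ≤ U k ω := le_trans (by linarith) hw
    have hwU' : w ≤ U k ω := by
      have := mul_nonneg hητ'.le hw0
      exact le_trans (by linarith) hw
    constructor
    · simp only [hφ, hf]
      refine h1.trans (by
        have h3 : (η * τ * w) ^ 2 ≤ U k ω ^ 2 := pow_le_pow_left₀ (by positivity) hwU 2
        have h4 : η / 8 * w ^ 2 = η / (8 * (η * τ) ^ 2) * (η * τ * w) ^ 2 := by field_simp
        rw [h4]
        gcongr)
    · refine h2.trans ?_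
      gcongr
  have hx_int : ∀ k, Integrable (fun ω => ‖x k ω - xstar‖ ^ 2) P := fun k => by
    induction k with
    | zero => exact (memLp_two_iff_integrable_sq_norm
        ((hx_meas 0).sub aestronglyMeasurable_const)).1 (hx0.sub (memLp_const xstar))
    | succ k ih =>
      refine Integrable.mono' ((ih.const_mul (2 * (5 / 4) ^ 2)).add
        ((hU_int k).const_mul (2 * (η / 4) ^ 2)))
        (((hx_meas (k + 1)).sub aestronglyMeasurable_const).norm.pow 2) ?_
      filter_upwards [hstep k] with ω hω
      rw [Real.norm_of_nonneg (by positivity), Pi.add_apply]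
      refine (pow_le_pow_left₀ (norm_nonneg _) hω.2 2).trans ?_
      have := sq_nonneg (5 / 4 * ‖x k ω - xstar‖ - η / 4 * U k ω)
      linarith
  have hφ_int : ∀ k, Integrable (fun ω => φ (x k ω)) P := fun k => by
    refine Integrable.mono' ((hx_int k).const_mul (1 / (2 * η)))
      (hφ_meas.comp_aemeasurable (hx_meas k).aemeasurable).aestronglyMeasurable
      (Filter.Eventually.of_forall fun ω => ?_)
    rw [Real.norm_of_nonneg (hφ_nonneg _)]
    exact hφ_upper _
  -- the sharper constant `η / 8` would do in place of `5 η / 16`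
  set B : ℝ := 5 * η * ν₁ ^ 2 / (16 * N₀) with hB
  have hrec : ∀ k, ∫ ω, φ (x (k + 1) ω) ∂P ≤ d * ∫ ω, φ (x k ω) ∂P + B * q ^ k := fun k => by
    have h1 := integral_mono_ae (hφ_int (k + 1)) (((hφ_int k).const_mul d).add
      ((hU_int k).const_mul (η / (8 * (η * τ) ^ 2)))) ((hstep k).mono fun ω hω => hω.1)
    rw [integral_add' ((hφ_int k).const_mul d) ((hU_int k).const_mul _), integral_const_mul,
      integral_const_mul] at h1
    refine h1.trans (add_le_add le_rfl ?_)
    calc η / (8 * (η * τ) ^ 2) * ∫ ω, U k ω ^ 2 ∂P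
        ≤ η / (8 * (η * τ) ^ 2) * (ν ^ 2 / (batchSize N₀ q k : ℝ)) := by
          have := hu.integral_le k
          gcongr
      _ = η / 8 * ν₁ ^ 2 * (1 / (batchSize N₀ q k : ℝ)) := by rw [hν₁]; field_simp
      _ ≤ η / 8 * ν₁ ^ 2 * (q ^ k / N₀) := by
          have := one_div_batchSize_le hN₀ hq0 k
          gcongr
      _ ≤ η * 5 / 16 * ν₁ ^ 2 * (q ^ k / N₀) := by
          gcongr ?_ * _ * _
          linarith
      _ = B * q ^ k := by rw [hB]; ring
  have hB0 : 0 ≤ B := by positivity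
  have hrate : ∀ k, ∫ ω, φ (x k ω) ∂P ≤ (∫ ω, φ (x 0 ω) ∂P + B / (c₁ - c₂)) * c₁ ^ k := fun k => by
    rw [hc₁, hc₂]
    exact le_mul_max_pow_of_le_mul_add (a := fun k => ∫ ω, φ (x k ω) ∂P) hd0 hq0.le hqd hB0
      (integral_nonneg fun ω => hφ_nonneg _) hrec k
  set A : ℝ := ∫ ω, φ (x 0 ω) ∂P + B / (c₁ - c₂) with hA
  have hDA : D = 2 * (1 + η * τ) / τ * A := by
    have hc : c₁ - c₂ ≠ 0 := by
      rw [hc₁, hc₂, max_sub_min_eq_abs]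
      exact abs_ne_zero.2 (sub_ne_zero.2 hqd.symm)
    rw [hD, hA, hB]
    field_simp
    ring
  have hmain : ∀ k, ∫ ω, ‖x k ω - xstar‖ ^ 2 ∂P ≤ D * c₁ ^ k := fun k => by
    have h1 := integral_mono ((hx_int k).const_mul _) (hφ_int k) fun ω => hφ_lower (x k ω)
    rw [integral_const_mul] at h1
    have h2 := h1.trans (hrate k)
    rw [div_mul_eq_mul_div, div_le_iff₀ (by positivity)] at h2
    rw [hDA, div_mul_eq_mul_div, div_mul_eq_mul_div, le_div_iff₀ hτ]
    linarith
  refine ⟨fun k => ⟨hx_int (k + 1), hmain (k + 1)⟩, ?_⟩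
  have hc0 : 0 < c₁ := hc₁ ▸ lt_max_of_lt_left hq0
  have hc1 : c₁ < 1 := hc₁ ▸ max_lt hq1 hd1
  set M : ℝ := max 1 (max A D) with hM
  have hAM : A ≤ M := (le_max_left _ _).trans (le_max_right _ _)
  have hDM : D ≤ M := (le_max_right _ _).trans (le_max_right _ _)
  have hM1 : 1 ≤ M := le_max_left _ _
  obtain ⟨C, hC, hCε⟩ := exists_pow_le_of_le_log hc0 hc1 hM1
  have h1q : 0 < 1 - q := sub_pos.2 hq1
  refine ⟨C + ((N₀ : ℝ) + 1) / (1 - q) * M, by positivity, fun ε hε hε2 => ?_⟩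
  obtain ⟨K, hK, hKlog, hKpow⟩ := hCε ε hε hε2
  have hcK : 0 ≤ c₁ ^ (K + 1) := by positivity
  refine ⟨K, ?_, ?_, ?_, ?_, fun hdq => ?_⟩
  · exact (hmain (K + 1)).trans ((mul_le_mul_of_nonneg_right hDM hcK).trans hK)
  · refine ((hφ_int (K + 1)).add
      (integrable_const (μ := P) (moreauEnvelope f η xstar).toReal)).congr ?_
    exact Filter.Eventually.of_forall fun ω => by simp [hφ]
  · exact (hrate (K + 1)).trans ((mul_le_mul_of_nonneg_right hAM hcK).trans hK)
  · refine hKlog.trans (mul_le_mul_of_nonneg_right ?_ (Real.log_nonneg ?_))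
    · have : 0 ≤ ((N₀ : ℝ) + 1) / (1 - q) * M := by positivity
      linarith
    · rw [le_div_iff₀ hε]
      linarith
  · have hcq : c₁ = q := by rw [hc₁, max_eq_left hdq.le]
    rw [hcq] at hKpow
    calc _ ≤ ((N₀ : ℝ) + 1) / (1 - q) * (q ^ K)⁻¹ := sum_batchSize_le N₀ hq0 hq1 K
      _ ≤ ((N₀ : ℝ) + 1) / (1 - q) * (M / ε) := by gcongr
      _ = ((N₀ : ℝ) + 1) / (1 - q) * M / ε := by rw [mul_div_assoc]
      _ ≤ _ := by gcongr; linarith
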